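/- Let $(M,g)$ be a smooth Riemannian manifold without boundary (finite-dimensional, Hausdorff, second countable, possibly geodesically incomplete), with Riemannian volume measure $\mu_g$. Let $V\to M$ be a smooth real vector bundle of finite rank with a smooth bundle metric $h$ and a smooth connection $\nabla$ compatible with $h$, i.e. $X\,h(\sigma,\tau)=h(\nabla_X\sigma,\tau)+h(\sigma,\nabla_X\tau)$. (A complex bundle with a Hermitian metric, or the complexification of a real bundle, is included by regarding it as a real bundle with the real part of the metric; this changes none of the norms below.) Let $\|u\|=\big(\int_M |u|_h^2\,d\mu_g\big)^{1/2}$ be the $L^2$-norm on measurable sections of $V$, let $\|\cdot\|$ denote likewise the $L^2$-norm on measurable sections of $T^*M\otimes V$ with the metric induced by $g$ and $h$, and let $L^\infty(V)$ be the set of measurable sections $u$ such that $|u|_h\le C$ $\mu_g$-a.e. for some $C>0$. Put $$S_1(V)=\{u\in C^\infty(V)\cap L^2(V):\ \nabla u\in L^2(T^*M\otimes V)\},$$ and let $W^{1,2}(V)$ be the closure of $S_1(V)$ under the norm $\|u\|_{W^{1,2}}=\|u\|+\|\nabla u\|$: that is, $u\in W^{1,2}(V)$ with $\nabla u=w$ means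 that $u\in L^2(V)$, $w\in L^2(T^*M\otimes V)$ and there are $s_k\in S_1(V)$ with $\|s_k-u\|\to0$ and $\|\nabla s_k-w\|\to 0$. Then $L^\infty(V)\cap W^{1,2}(V)$ is dense in $W^{1,2}(V)$: for every $u\in W^{1,2}(V)$ and every $\varepsilon>0$ there is $u'\in L^\infty(V)\cap W^{1,2}(V)$ with $\|u'-u\|+\|\nabla u'-\nabla u\|<\varepsilon$. -/

import Mathlib

open Bundle MeasureTheory Filter Manifold
open scoped ContDiff Topology ENNReal

noncomputable section

namespace BundleSobolev

/-! ### The Riemannian volume measure -/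

section Volume

variable {n : ℕ} {M : Type*} [TopologicalSpace M] [ChartedSpace (EuclideanSpace ℝ (Fin n)) M]
  [RiemannianBundle (fun x : M => TangentSpace (𝓡 n) x)]

/-- The coordinate vector field `∂ᵢ` of the chart `φ`, at the point with coordinates `y`. -/
def coordVector (φ : OpenPartialHomeomorph M (EuclideanSpace ℝ (Fin n)))
    (y : EuclideanSpace ℝ (Fin n)) (i : Fin n) : TangentSpace (𝓡 n) (φ.symm y) :=
  mfderiv (𝓡 n) (𝓡 n) φ.symm y (EuclideanSpace.single i (1 : ℝ) : EuclideanSpace ℝ (Fin n))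

/-- The Gram matrix `gᵢⱼ = g(∂ᵢ, ∂ⱼ)` of the metric in the chart `φ`. -/
def gramMatrix (φ : OpenPartialHomeomorph M (EuclideanSpace ℝ (Fin n)))
    (y : EuclideanSpace ℝ (Fin n)) : Matrix (Fin n) (Fin n) ℝ :=
  Matrix.of fun i j => inner ℝ (coordVector φ y i) (coordVector φ y j)

variable [MeasurableSpace M]

/-- The Riemannian volume of the domain of the chart `φ`, extended by zero to `M`:
the image under `φ⁻¹` of the measure `√(det gᵢⱼ) dy` on the target of `φ`. -/
def chartVolume (φ : OpenPartialHomeomorph M (EuclideanSpace ℝ (Fin n))) : Measure M :=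
  Measure.map φ.symm
    ((volume.restrict φ.target).withDensity
      fun y => ENNReal.ofReal (Real.sqrt (gramMatrix φ y).det))

variable (n M) in
/-- The Riemannian volume measure `μ_g`. The measures `chartVolume φ` are the restrictions of
`μ_g` to the chart domains, which cover `M`, so that `μ_g` is their supremum. -/
def riemannianVolume : Measure M :=
  ⨆ x : M, chartVolume (chartAt (EuclideanSpace ℝ (Fin n)) x)

end Volume

/-! ### Measurable sections -/

/-- A section of a vector bundle is measurable if its coefficients in the trivialisations are
measurable, up to sets of measure zero. -/
def MeasurableSection {M : Type*} [TopologicalSpace M] [MeasurableSpace M] (μ : Measure M)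
    (F : Type*) [NormedAddCommGroup F] [NormedSpace ℝ F]
    {V : M → Type*} [TopologicalSpace (TotalSpace F V)] [∀ x, TopologicalSpace (V x)]
    [FiberBundle F V] (u : Π x, V x) : Prop :=
  ∀ (e : Trivialization F (TotalSpace.proj : TotalSpace F V → M)) [MemTrivializationAtlas e],
    AEStronglyMeasurable (fun x => (e (TotalSpace.mk' F x (u x))).2) (μ.restrict e.baseSet)

section Sobolev

variable {n : ℕ} {M : Type*} [TopologicalSpace M] [ChartedSpace (EuclideanSpace ℝ (Fin n)) M]
  [IsManifold (𝓡 n) ∞ M] [MeasurableSpace M]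
  [RiemannianBundle (fun x : M => TangentSpace (𝓡 n) x)]
  {F : Type*} [NormedAddCommGroup F] [NormedSpace ℝ F]
  {V : M → Type*} [TopologicalSpace (TotalSpace F V)]
  [∀ x, NormedAddCommGroup (V x)] [∀ x, InnerProductSpace ℝ (V x)]
  [FiberBundle F V] [VectorBundle ℝ F V]

/-- The norm on `T*ₓM ⊗ Vₓ = Hom(TₓM, Vₓ)` induced by the metrics `g` and `h`:
`|A|² = ∑ᵢ |A eᵢ|²` for an orthonormal basis `eᵢ` of `TₓM`. -/
def cotangentTensorNorm {x : M} (A : TangentSpace (𝓡 n) x →L[ℝ] V x) : ℝ :=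
  haveI : FiniteDimensional ℝ (TangentSpace (𝓡 n) x) :=
    inferInstanceAs (FiniteDimensional ℝ (EuclideanSpace ℝ (Fin n)))
  Real.sqrt (∑ i, ‖A (stdOrthonormalBasis ℝ (TangentSpace (𝓡 n) x) i)‖ ^ 2)

variable (n) in
/-- The `L²` norm of a section of `V`, with values in `[0, ∞]`. -/
def normL2 (u : Π x : M, V x) : ℝ≥0∞ :=
  eLpNorm (fun x => ‖u x‖) 2 (riemannianVolume n M)

/-- The `L²` norm of a section of `T*M ⊗ V`, with values in `[0, ∞]`. -/
def normL2Cotangent (w : Π x : M, TangentSpace (𝓡 n) x →L[ℝ] V x) : ℝ≥0∞ :=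
  eLpNorm (fun x => cotangentTensorNorm (w x)) 2 (riemannianVolume n M)

variable (n F) in
/-- `u ∈ L²(V)`. -/
def MemL2 (u : Π x : M, V x) : Prop :=
  MeasurableSection (riemannianVolume n M) F u ∧ normL2 n u < ⊤

variable (F) in
/-- `w ∈ L²(T*M ⊗ V)`. -/
def MemL2Cotangent (w : Π x : M, TangentSpace (𝓡 n) x →L[ℝ] V x) : Prop :=
  MeasurableSection (V := fun x => TangentSpace (𝓡 n) x →L[ℝ] V x) (riemannianVolume n M)
    (EuclideanSpace ℝ (Fin n) →L[ℝ] F) w ∧ normL2Cotangent w < ⊤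

variable (n F) in
/-- `u ∈ L^∞(V)`. -/
def MemLinfty (u : Π x : M, V x) : Prop :=
  MeasurableSection (riemannianVolume n M) F u ∧
    ∃ C > 0, ∀ᵐ x ∂(riemannianVolume n M), ‖u x‖ ≤ C

/-- `u ∈ S₁(V)`: the section `u` is smooth, `u ∈ L²(V)` and `∇u ∈ L²(T*M ⊗ V)`. -/
def MemS1 (D : CovariantDerivative (𝓡 n) F V) (u : Π x : M, V x) : Prop :=
  ContMDiff (𝓡 n) ((𝓡 n).prod 𝓘(ℝ, F)) ∞ (fun x => TotalSpace.mk' F x (u x)) ∧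
    MemL2 n F u ∧ MemL2Cotangent F (D u)

/-- `u ∈ W^{1,2}(V)` with `∇u = w`. The space `W^{1,2}(V)` is the closure of `S₁(V)` under the
norm `‖u‖ + ‖∇u‖`, and `∇` extends to it as the closure of the operator `∇ : S₁(V) → L²(T*M ⊗ V)`.
So this says that `(u, w)` lies in the closure in `L²(V) × L²(T*M ⊗ V)` of the graph of `∇`
on `S₁(V)`. -/
def HasSobolevGradient (D : CovariantDerivative (𝓡 n) F V) (u : Π x : M, V x)
    (w : Π x : M, TangentSpace (𝓡 n) x →L[ℝ] V x) : Prop :=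
  MemL2 n F u ∧ MemL2Cotangent F w ∧
    ∃ s : ℕ → Π x : M, V x, (∀ k, MemS1 D (s k)) ∧
      Tendsto (fun k => normL2 n (s k - u)) atTop (𝓝 0) ∧
      Tendsto (fun k => normL2Cotangent (D (s k) - w)) atTop (𝓝 0)

end Sobolev

end BundleSobolev

end

/-!
Density of `L^∞ ∩ W^{1,2}` in `W^{1,2}` for sections of a metric bundle with metric connection.

By definition `S₁` is dense in `W^{1,2}`, so it is enough to approximate a smooth section `s ∈ S₁`.
The approximation is the soft truncation `s_δ = a s`, with `a = (1 + δ|s|²)⁻¹` and `δ > 0`. It is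
smooth, because `a` is a smooth function of the smooth function `|s|²`, and it is bounded. Since the
connection is metric, `d|s|² = 2 ⟨∇s, s⟩`, and the Leibniz rule gives
`∇s_δ = a ∇s - 2δ a² ⟨∇s, s⟩ s` (`covariantDerivative_softTruncation`). As `δ |s|² a = 1 - a`,
both `|s_δ - s| ≤ 3 (1 - a) |s|` and `|∇s_δ - ∇s| ≤ 3 (1 - a) |∇s|` hold pointwise
(`norm_covariantDerivative_softTruncation_sub_le`). Here `0 ≤ 1 - a ≤ 1`, and `1 - a → 0` pointwise
as `δ → 0`, so dominated convergence shows that `s_δ → s` and `∇s_δ → ∇s` in `L²`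
(`MemS1.tendsto_softTruncation`). The `s_δ` themselves lie in `S₁`, so no regularisation is needed,
and neither completeness of `M` nor cut-off functions play a role.

The measure theory needs `x ↦ |∇s|(x)` to be measurable, although the Hilbert–Schmidt norm is
defined by an orthonormal basis chosen separately at each point. The norm does not depend on the
basis, and Gram–Schmidt turns a local frame of `TM` into a continuous orthonormal frame, so the norm
of a continuous section of `T*M ⊗ V` is continuous (`continuous_cotangentTensorNorm`).
-/

namespace BundleSobolev

/-! ### The Hilbert–Schmidt norm on `T*M ⊗ V` -/

/-- The Hilbert–Schmidt norm does not depend on the orthonormal basis. Neither space has to be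
complete: expanding `e i` in the basis `f` reduces the claim to Parseval's identity. -/
theorem sum_sq_norm_map_orthonormalBasis_eq {ι κ E G : Type*} [Fintype ι] [Fintype κ]
    [NormedAddCommGroup E] [InnerProductSpace ℝ E] [NormedAddCommGroup G] [InnerProductSpace ℝ G]
    (e : OrthonormalBasis ι ℝ E) (f : OrthonormalBasis κ ℝ E) (A : E →ₗ[ℝ] G) :
    ∑ i, ‖A (e i)‖ ^ 2 = ∑ j, ‖A (f j)‖ ^ 2 := by
  classical
  have key : ∀ i, ‖A (e i)‖ ^ 2 =
      ∑ j, ∑ k, (inner ℝ (f j) (e i) * inner ℝ (e i) (f k)) * inner ℝ (A (f j)) (A (f k)) := by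
    intro i
    conv_lhs => rw [← real_inner_self_eq_norm_sq, ← f.sum_repr' (e i)]
    simp only [map_sum, map_smul, sum_inner, inner_sum, real_inner_smul_left, inner_smul_right,
      Finset.mul_sum]
    refine Finset.sum_congr rfl fun j _ => Finset.sum_congr rfl fun k _ => ?_
    rw [real_inner_comm (A (f j)), real_inner_comm (e i) (f k)]
    ring
  simp_rw [key]
  rw [Finset.sum_comm]
  refine Finset.sum_congr rfl fun j _ => ?_
  rw [Finset.sum_comm]
  simp_rw [← Finset.sum_mul, e.sum_inner_mul_inner, orthonormal_iff_ite.mp f.orthonormal]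
  simp

section

variable {n : ℕ} {M : Type*} [TopologicalSpace M] [ChartedSpace (EuclideanSpace ℝ (Fin n)) M]
  [RiemannianBundle (fun x : M => TangentSpace (𝓡 n) x)]
  {V : M → Type*}
  [∀ x, NormedAddCommGroup (V x)] [∀ x, InnerProductSpace ℝ (V x)]

theorem cotangentTensorNorm_eq_sqrt_sum {ι : Type*} [Fintype ι] {x : M}
    (e : OrthonormalBasis ι ℝ (TangentSpace (𝓡 n) x))
    (A : TangentSpace (𝓡 n) x →L[ℝ] V x) :
    cotangentTensorNorm A = Real.sqrt (∑ i, ‖A (e i)‖ ^ 2) := by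
  unfold cotangentTensorNorm
  exact congrArg Real.sqrt (sum_sq_norm_map_orthonormalBasis_eq _ e A.toLinearMap)

theorem cotangentTensorNorm_nonneg {x : M} (A : TangentSpace (𝓡 n) x →L[ℝ] V x) :
    0 ≤ cotangentTensorNorm A := Real.sqrt_nonneg _

theorem cotangentTensorNorm_le_mul {x : M} {A B : TangentSpace (𝓡 n) x →L[ℝ] V x} {c : ℝ}
    (hc : 0 ≤ c) (h : ∀ v, ‖A v‖ ≤ c * ‖B v‖) :
    cotangentTensorNorm A ≤ c * cotangentTensorNorm B := by
  unfold cotangentTensorNorm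
  refine Real.sqrt_le_iff.mpr ⟨by positivity, ?_⟩
  rw [mul_pow, Real.sq_sqrt (by positivity), Finset.mul_sum]
  gcongr with i
  rw [← mul_pow]
  gcongr
  exact h _

theorem cotangentTensorNorm_add_le {x : M} (A B : TangentSpace (𝓡 n) x →L[ℝ] V x) :
    cotangentTensorNorm (A + B) ≤ cotangentTensorNorm A + cotangentTensorNorm B := by
  have : FiniteDimensional ℝ (TangentSpace (𝓡 n) x) :=
    inferInstanceAs (FiniteDimensional ℝ (EuclideanSpace ℝ (Fin n)))
  have key : ∀ C : TangentSpace (𝓡 n) x →L[ℝ] V x, cotangentTensorNorm C =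
      ‖WithLp.toLp 2 fun i => C (stdOrthonormalBasis ℝ (TangentSpace (𝓡 n) x) i)‖ := fun C => by
    rw [PiLp.norm_eq_of_L2]
    rfl
  rw [key, key, key]
  exact norm_add_le (WithLp.toLp 2 fun i => A (stdOrthonormalBasis ℝ (TangentSpace (𝓡 n) x) i))
    (WithLp.toLp 2 fun i => B (stdOrthonormalBasis ℝ (TangentSpace (𝓡 n) x) i))

end

section

variable {E : Type*} [NormedAddCommGroup E] [NormedSpace ℝ E]
  {H : Type*} [TopologicalSpace H] {I : ModelWithCorners ℝ E H}
  {M : Type*} [TopologicalSpace M] [ChartedSpace H M]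
  {F : Type*} [NormedAddCommGroup F] [NormedSpace ℝ F]
  {V : M → Type*} [TopologicalSpace (TotalSpace F V)]
  [∀ x, NormedAddCommGroup (V x)] [∀ x, InnerProductSpace ℝ (V x)]
  [FiberBundle F V] [VectorBundle ℝ F V] {k : WithTop ℕ∞}
  [IsContMDiffRiemannianBundle I k F V]

/-- The Gram–Schmidt process turns sections that are `C^k` at `x₀`, and linearly independent
there, into sections that are `C^k` at `x₀`. -/
theorem _root_.ContMDiffAt.gramSchmidt_section {ι : Type*} [LinearOrder ι] [LocallyFiniteOrderBot ι]
    [WellFoundedLT ι] {b : ι → Π x : M, V x} {x₀ : M}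
    (hb : ∀ i, ContMDiffAt I (I.prod 𝓘(ℝ, F)) k (fun x => TotalSpace.mk' F x (b i x)) x₀)
    (hli : LinearIndependent ℝ fun i => b i x₀) (i : ι) :
    ContMDiffAt I (I.prod 𝓘(ℝ, F)) k (fun x => TotalSpace.mk' F x
      (InnerProductSpace.gramSchmidt ℝ (fun j => b j x) i)) x₀ := by
  induction i using WellFoundedLT.induction with
  | ind i ih =>
  have h : ∀ x, InnerProductSpace.gramSchmidt ℝ (fun j => b j x) i = b i x -
      ∑ j ∈ Finset.Iio i, (inner ℝ (InnerProductSpace.gramSchmidt ℝ (fun j => b j x) j) (b i x) /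
        inner ℝ (InnerProductSpace.gramSchmidt ℝ (fun j => b j x) j)
          (InnerProductSpace.gramSchmidt ℝ (fun j => b j x) j)) •
        InnerProductSpace.gramSchmidt ℝ (fun j => b j x) j := by
    intro x
    rw [eq_sub_iff_add_eq]
    simp only [real_inner_self_eq_norm_sq]
    exact (InnerProductSpace.gramSchmidt_def'' ℝ (fun j => b j x) i).symm
  simp_rw [h]
  -- The projection coefficients are `C^k`, as the earlier vectors do not vanish at `x₀`.
  refine (hb i).sub_section (ContMDiffAt.sum_section fun j hj => ?_)
  have hj' := ih j (Finset.mem_Iio.mp hj)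
  refine ContMDiffAt.smul_section ?_ hj'
  refine (hj'.inner_bundle (hb i)).div₀ (hj'.inner_bundle hj') ?_
  exact inner_self_ne_zero.mpr (InnerProductSpace.gramSchmidt_ne_zero j hli)

end

section

variable {n : ℕ} {M : Type*} [TopologicalSpace M] [ChartedSpace (EuclideanSpace ℝ (Fin n)) M]
  [IsManifold (𝓡 n) ∞ M]
  [RiemannianBundle (fun x : M => TangentSpace (𝓡 n) x)]
  [IsContMDiffRiemannianBundle (𝓡 n) ∞ (EuclideanSpace ℝ (Fin n))
      (fun x : M => TangentSpace (𝓡 n) x)]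
  {F : Type*} [NormedAddCommGroup F] [NormedSpace ℝ F]
  {V : M → Type*} [TopologicalSpace (TotalSpace F V)]
  [∀ x, NormedAddCommGroup (V x)] [∀ x, InnerProductSpace ℝ (V x)]
  [FiberBundle F V] [VectorBundle ℝ F V] [IsContMDiffRiemannianBundle (𝓡 n) ∞ F V]

/-- Near each point the Hilbert–Schmidt norm can be computed in the orthonormal frame obtained from
a local frame by the Gram–Schmidt process, hence it is continuous there. -/
theorem continuous_cotangentTensorNorm {A : Π x : M, TangentSpace (𝓡 n) x →L[ℝ] V x}
    (hA : ContMDiff (𝓡 n) ((𝓡 n).prod 𝓘(ℝ, EuclideanSpace ℝ (Fin n) →L[ℝ] F)) 0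
      (fun x => TotalSpace.mk' (EuclideanSpace ℝ (Fin n) →L[ℝ] F)
        (E := fun x : M => TangentSpace (𝓡 n) x →L[ℝ] V x) x (A x))) :
    Continuous fun x => cotangentTensorNorm (A x) := by
  rw [continuous_iff_continuousAt]
  intro x₀
  have hR : IsContMDiffRiemannianBundle (𝓡 n) 0 (EuclideanSpace ℝ (Fin n))
      (fun x : M => TangentSpace (𝓡 n) x) :=
    IsContMDiffRiemannianBundle.of_le (n := ∞) (by simp)
  let T := trivializationAt (EuclideanSpace ℝ (Fin n)) (fun x : M => TangentSpace (𝓡 n) x) x₀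
  let b₀ := (EuclideanSpace.basisFun (Fin n) ℝ).toBasis
  let b := T.localFrame b₀
  have hx₀ : x₀ ∈ T.baseSet := FiberBundle.mem_baseSet_trivializationAt' x₀
  have hli : ∀ x ∈ T.baseSet, LinearIndependent ℝ fun i => b i x := fun x hx =>
    (T.isLocalFrameOn_localFrame_baseSet (𝓡 n) 0 b₀).linearIndependent hx
  let g : Fin n → Π x : M, TangentSpace (𝓡 n) x := fun i x =>
    InnerProductSpace.gramSchmidt ℝ (fun j => b j x) i
  have hg : ∀ i, ContMDiffAt (𝓡 n) ((𝓡 n).prod 𝓘(ℝ, EuclideanSpace ℝ (Fin n))) 0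
      (fun x => TotalSpace.mk' (EuclideanSpace ℝ (Fin n)) x (g i x)) x₀ :=
    ContMDiffAt.gramSchmidt_section (fun i => contMDiffAt_localFrame_of_mem 0 T b₀ i hx₀)
      (hli x₀ hx₀)
  have hAg : ∀ i, ContMDiffAt (𝓡 n) ((𝓡 n).prod 𝓘(ℝ, F)) 0
      (fun x => TotalSpace.mk' F x (A x (g i x))) x₀ := fun i =>
    (hA x₀).clm_bundle_apply (hg i)
  have hcont : ContinuousAt (fun x => Real.sqrt (∑ i,
      inner ℝ (A x (g i x)) (A x (g i x)) / inner ℝ (g i x) (g i x))) x₀ := by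
    refine ContinuousAt.sqrt (tendsto_finsetSum _ fun i _ => ?_)
    refine ContinuousAt.div ((hAg i).inner_bundle (hAg i)).continuousAt
      ((hg i).inner_bundle (hg i)).continuousAt ?_
    exact inner_self_ne_zero.mpr (InnerProductSpace.gramSchmidt_ne_zero i (hli x₀ hx₀))
  refine hcont.congr ?_
  filter_upwards [T.open_baseSet.mem_nhds hx₀] with x hx
  have : FiniteDimensional ℝ (TangentSpace (𝓡 n) x) :=
    inferInstanceAs (FiniteDimensional ℝ (EuclideanSpace ℝ (Fin n)))
  have hdim : Module.finrank ℝ (TangentSpace (𝓡 n) x) = Fintype.card (Fin n) := by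
    change Module.finrank ℝ (EuclideanSpace ℝ (Fin n)) = _
    simp
  rw [cotangentTensorNorm_eq_sqrt_sum
    (InnerProductSpace.gramSchmidtOrthonormalBasis hdim fun j => b j x)]
  congr 1
  refine Finset.sum_congr rfl fun i _ => ?_
  have hne : InnerProductSpace.gramSchmidtNormed ℝ (fun j => b j x) i ≠ 0 := by
    rw [← norm_ne_zero_iff, InnerProductSpace.gramSchmidtNormed_unit_length i (hli x hx)]
    exact one_ne_zero
  rw [InnerProductSpace.gramSchmidtOrthonormalBasis_apply hdim hne,
    InnerProductSpace.gramSchmidtNormed, map_smul, norm_smul, mul_pow]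
  simp only [real_inner_self_eq_norm_sq, g, RCLike.ofReal_real_eq_id, id, norm_inv, norm_norm]
  field_simp

end

/-! ### `L²` estimates and measurability -/

section

variable {α : Type*} [MeasurableSpace α] {μ : Measure α}

theorem eLpNorm_two_eq_lintegral (f : α → ℝ) :
    eLpNorm f 2 μ = (∫⁻ x, ‖f x‖ₑ ^ (2 : ℝ) ∂μ) ^ (1 / 2 : ℝ) := by
  rw [eLpNorm_eq_lintegral_rpow_enorm_toReal (by norm_num) (by norm_num)]
  norm_num

/-- Minkowski's inequality, with measurability assumed of one summand only. This matters for the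
norms `|u|` and `|w|` of merely measurable sections, of which it is not known a priori. -/
theorem eLpNorm_two_le_add_of_le {f g h : α → ℝ} (hf : ∀ x, 0 ≤ f x) (hfgh : ∀ x, f x ≤ g x + h x)
    (hg : AEMeasurable g μ) : eLpNorm f 2 μ ≤ eLpNorm g 2 μ + eLpNorm h 2 μ := by
  -- The lower integral of `f²` is attained by a measurable `φ ≤ f²`, and `√φ - g ≤ h` is then
  -- measurable too, so that the usual inequality applies to `√φ ≤ g + (√φ - g)`.
  obtain ⟨φ, hφ, hφf, hφi⟩ := exists_measurable_le_lintegral_eq μ fun x => ‖f x‖ₑ ^ (2 : ℝ)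
  rw [eLpNorm_two_eq_lintegral f, eLpNorm_two_eq_lintegral g, eLpNorm_two_eq_lintegral h, hφi]
  have hgm : AEMeasurable (fun x => ‖g x‖ₑ) μ := hg.enorm
  have hψ : AEMeasurable (fun x => φ x ^ (1 / 2 : ℝ) - ‖g x‖ₑ) μ :=
    (hφ.pow_const _).aemeasurable.sub hgm
  have hle : ∀ x, φ x ^ (1 / 2 : ℝ) - ‖g x‖ₑ ≤ ‖h x‖ₑ := fun x => by
    rw [tsub_le_iff_left]
    calc φ x ^ (1 / 2 : ℝ) ≤ (‖f x‖ₑ ^ (2 : ℝ)) ^ (1 / 2 : ℝ) := by gcongr; exact hφf x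
      _ = ‖f x‖ₑ := by rw [← ENNReal.rpow_mul]; norm_num
      _ ≤ ‖g x + h x‖ₑ := by
        rw [enorm_le_iff_norm_le, Real.norm_of_nonneg (hf x)]
        exact (hfgh x).trans (le_abs_self _)
      _ ≤ ‖g x‖ₑ + ‖h x‖ₑ := enorm_add_le _ _
  calc (∫⁻ x, φ x ∂μ) ^ (1 / 2 : ℝ)
      ≤ (∫⁻ x, ((fun x => ‖g x‖ₑ) + fun x => φ x ^ (1 / 2 : ℝ) - ‖g x‖ₑ) x ^ (2 : ℝ) ∂μ)
          ^ (1 / 2 : ℝ) := by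
        gcongr with x
        calc φ x = (φ x ^ (1 / 2 : ℝ)) ^ (2 : ℝ) := by rw [← ENNReal.rpow_mul]; norm_num
          _ ≤ _ := by gcongr; exact (le_add_tsub : _ ≤ ‖g x‖ₑ + (φ x ^ (1 / 2 : ℝ) - ‖g x‖ₑ))
    _ ≤ _ := ENNReal.lintegral_Lp_add_le hgm hψ one_le_two
    _ ≤ _ := by gcongr with x; exact hle x

/-- Dominated convergence in `L²`: if `|f k| ≤ |η k * G|` with `G ∈ L²` and uniformly bounded
multipliers `η k → 0`, then `f k → 0` in `L²`. The `f k` need not be measurable. -/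
theorem tendsto_eLpNorm_two_zero_of_le_mul {f η : ℕ → α → ℝ} {G : α → ℝ} {c : ℝ}
    (hG : AEMeasurable G μ) (hG2 : eLpNorm G 2 μ < ⊤)
    (hη : ∀ k, AEMeasurable (η k) μ) (hηc : ∀ k x, |η k x| ≤ c)
    (hη0 : ∀ x, Tendsto (fun k => η k x) atTop (𝓝 0))
    (hf : ∀ k x, |f k x| ≤ |η k x * G x|) :
    Tendsto (fun k => eLpNorm (f k) 2 μ) atTop (𝓝 0) := by
  have hmain : Tendsto (fun k => eLpNorm (fun x => η k x * G x) 2 μ) atTop (𝓝 0) := by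
    have hdom : Tendsto (fun k => ∫⁻ x, ‖η k x * G x‖ₑ ^ (2 : ℝ) ∂μ) atTop
        (𝓝 (∫⁻ _, 0 ∂μ)) := by
      refine tendsto_lintegral_of_dominated_convergence' (fun x => ‖c * G x‖ₑ ^ (2 : ℝ))
        (fun k => ((hη k).mul hG).enorm.pow_const _) (fun k => ae_of_all _ fun x => ?_) ?_
        (ae_of_all _ fun x => ?_)
      · refine ENNReal.rpow_le_rpow ?_ zero_le_two
        rw [enorm_le_iff_norm_le, norm_mul, norm_mul]
        gcongr
        exact (hηc k x).trans (le_abs_self c)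
      · have h : eLpNorm (fun x => c * G x) 2 μ < ⊤ := by
          have := eLpNorm_const_smul c G 2 μ
          simp only [Pi.smul_def, smul_eq_mul] at this
          rw [this]
          exact ENNReal.mul_lt_top (by simp) hG2
        rw [eLpNorm_two_eq_lintegral] at h
        intro htop
        rw [htop, ENNReal.top_rpow_of_pos (by norm_num)] at h
        exact lt_irrefl _ h
      · have h : Tendsto (fun k => ‖η k x * G x‖ₑ ^ (2 : ℝ)) atTop
            (𝓝 (‖(0 : ℝ) * G x‖ₑ ^ (2 : ℝ))) :=
          (((hη0 x).mul_const (G x)).enorm).ennrpow_const 2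
        simpa using h
    simp_rw [eLpNorm_two_eq_lintegral]
    have := hdom.ennrpow_const (1 / 2 : ℝ)
    simpa using this
  refine tendsto_of_tendsto_of_tendsto_of_le_of_le tendsto_const_nhds hmain (fun _ => zero_le)
    fun k => ?_
  exact eLpNorm_mono (hf k)

end

theorem measurableSection_of_continuous {M : Type*} [TopologicalSpace M]
    [SecondCountableTopology M] [MeasurableSpace M] [BorelSpace M] (μ : Measure M)
    {F : Type*} [NormedAddCommGroup F] [NormedSpace ℝ F]
    {V : M → Type*} [TopologicalSpace (TotalSpace F V)] [∀ x, TopologicalSpace (V x)]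
    [FiberBundle F V] {u : Π x, V x} (hu : Continuous fun x => TotalSpace.mk' F x (u x)) :
    MeasurableSection μ F u := by
  intro e _
  refine ContinuousOn.aestronglyMeasurable ?_ e.open_baseSet.measurableSet
  refine continuous_snd.comp_continuousOn (e.continuousOn.comp hu.continuousOn fun x hx => ?_)
  exact e.mem_source.mpr hx

/-! ### Soft truncation of a section -/

section

variable {M : Type*} {V : M → Type*} [∀ x, NormedAddCommGroup (V x)]
  [∀ x, InnerProductSpace ℝ (V x)]

/-- The soft truncation `s / (1 + δ|s|²)` of a section `s`. It tends to `s` as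
`δ → 0`, and is bounded for `δ > 0`. -/
noncomputable def softTruncation (δ : ℝ) (s : Π x, V x) : Π x, V x :=
  (fun x => (1 + δ * ‖s x‖ ^ 2)⁻¹) • s

/-- The bound `1 + δ⁻¹` is convenient rather than sharp: the optimal one is `1 / (2√δ)`. -/
theorem norm_softTruncation_le {δ : ℝ} (hδ : 0 < δ) (s : Π x, V x) (x : M) :
    ‖softTruncation δ s x‖ ≤ 1 + δ⁻¹ := by
  have hpos : 0 < 1 + δ * ‖s x‖ ^ 2 := by positivity
  rw [softTruncation, Pi.smul_apply', norm_smul, norm_inv, Real.norm_of_nonneg hpos.le,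
    inv_mul_le_iff₀ hpos]
  have h : (1 + δ * ‖s x‖ ^ 2) * (1 + δ⁻¹) = 1 + δ⁻¹ + δ * ‖s x‖ ^ 2 + ‖s x‖ ^ 2 := by
    field_simp
    ring
  rw [h]
  have h1 : 0 < δ⁻¹ := inv_pos.mpr hδ
  have h2 : 0 ≤ δ * ‖s x‖ ^ 2 := by positivity
  nlinarith [sq_nonneg (‖s x‖ - 1)]

theorem norm_softTruncation_le_norm {δ : ℝ} (hδ : 0 ≤ δ) (s : Π x, V x) (x : M) :
    ‖softTruncation δ s x‖ ≤ ‖s x‖ := by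
  have hpos : 0 < 1 + δ * ‖s x‖ ^ 2 := by positivity
  rw [softTruncation, Pi.smul_apply', norm_smul, norm_inv, Real.norm_of_nonneg hpos.le]
  refine mul_le_of_le_one_left (norm_nonneg _) (inv_le_one_of_one_le₀ ?_)
  have : 0 ≤ δ * ‖s x‖ ^ 2 := by positivity
  linarith

end

section

variable {E : Type*} [NormedAddCommGroup E] [NormedSpace ℝ E]
  {H : Type*} [TopologicalSpace H] {I : ModelWithCorners ℝ E H}
  {M : Type*} [TopologicalSpace M] [ChartedSpace H M]
  {F : Type*} [NormedAddCommGroup F] [NormedSpace ℝ F]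
  {V : M → Type*} [TopologicalSpace (TotalSpace F V)]
  [∀ x, NormedAddCommGroup (V x)] [∀ x, InnerProductSpace ℝ (V x)]
  [FiberBundle F V] [VectorBundle ℝ F V]

theorem _root_.ContMDiff.continuous_norm_section [IsContMDiffRiemannianBundle I ∞ F V]
    {s : Π x : M, V x}
    (hs : ContMDiff I (I.prod 𝓘(ℝ, F)) ∞ fun x => TotalSpace.mk' F x (s x)) :
    Continuous fun x => ‖s x‖ := by
  simp_rw [norm_eq_sqrt_real_inner]
  exact (hs.inner_bundle hs).continuous.sqrt

theorem contMDiff_softTruncation [IsContMDiffRiemannianBundle I ∞ F V] {δ : ℝ} (hδ : 0 ≤ δ)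
    {s : Π x : M, V x}
    (hs : ContMDiff I (I.prod 𝓘(ℝ, F)) ∞ fun x => TotalSpace.mk' F x (s x)) :
    ContMDiff I (I.prod 𝓘(ℝ, F)) ∞ fun x => TotalSpace.mk' F x (softTruncation δ s x) := by
  refine ContMDiff.smul_section ?_ hs
  have hn : ContMDiff I 𝓘(ℝ) ∞ fun x => 1 + δ * ‖s x‖ ^ 2 := by
    simp_rw [← real_inner_self_eq_norm_sq]
    exact contMDiff_const.add (contMDiff_const.mul (hs.inner_bundle hs))
  exact hn.inv₀ fun x => by positivity

variable [FiniteDimensional ℝ F] [ContMDiffVectorBundle 1 F V I]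
  [IsContMDiffRiemannianBundle I 1 F V] {D : CovariantDerivative I F V}

/-- `∇s_δ = a ∇s - 2δ a² ⟨∇s, s⟩ s` for `a = (1 + δ|s|²)⁻¹`. Compatibility with the metric enters
through `d|s|² = 2 ⟨∇s, s⟩`. -/
theorem covariantDerivative_softTruncation (hD : D.IsMetricCompatible) {δ : ℝ} (hδ : 0 ≤ δ)
    {s : Π x : M, V x} {x : M}
    (hs : MDifferentiableAt I (I.prod 𝓘(ℝ, F)) (fun x => TotalSpace.mk' F x (s x)) x)
    (v : TangentSpace I x) :
    D (softTruncation δ s) x v = (1 + δ * ‖s x‖ ^ 2)⁻¹ • D s x v -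
      (2 * δ * (1 + δ * ‖s x‖ ^ 2)⁻¹ ^ 2 * inner ℝ (D s x v) (s x)) • s x := by
  classical
  let φ : ℝ → ℝ := fun t => (1 + δ * t)⁻¹
  let N : M → ℝ := fun y => inner ℝ (s y) (s y)
  have hN : MDifferentiableAt I 𝓘(ℝ) N x := hs.inner_bundle hs
  have hpos : 1 + δ * N x ≠ 0 := by
    simp only [N, real_inner_self_eq_norm_sq]
    positivity
  have hφ : HasDerivAt φ (-δ / (1 + δ * N x) ^ 2) (N x) := by
    have h : HasDerivAt (fun t => 1 + δ * t) δ (N x) := by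
      simpa using ((hasDerivAt_id (N x)).const_mul δ).const_add 1
    exact h.inv hpos
  have hφN : (fun x => (1 + δ * ‖s x‖ ^ 2)⁻¹) = φ ∘ N := by
    ext y
    simp [φ, N]
  have hφm : MDifferentiableAt 𝓘(ℝ) 𝓘(ℝ) φ (N x) :=
    hφ.differentiableAt.mdifferentiableAt
  have hdN : mvfderiv I N x v = 2 * inner ℝ (D s x v) (s x) := by
    -- Metric compatibility is stated for vector fields; any field with value `v` at `x` will do.
    have := hD.mvfderiv_inner_eq (fun y => if h : y = x then h ▸ v else 0) hs hs
    simp only [dite_true] at this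
    rw [this, real_inner_comm (D s x v) (s x)]
    ring
  have hda : mvfderiv I (φ ∘ N) x v =
      -δ / (1 + δ * N x) ^ 2 * (2 * inner ℝ (D s x v) (s x)) := by
    rw [← hdN, mvfderiv, mfderiv_comp x hφm hN, mfderiv_eq_fderiv, hφ.hasFDerivAt.fderiv]
    exact mul_comm (mvfderiv I N x v) _
  rw [softTruncation, hφN, D.isCovariantDerivativeOnUniv.leibniz hs (hφm.comp x hN)]
  simp only [add_apply, smul_apply,
    ContinuousLinearMap.smulRight_apply, hda, Function.comp, φ, sub_eq_add_neg, ← neg_smul]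
  simp only [N, real_inner_self_eq_norm_sq]
  congr 2
  field_simp

/-- The factor `3 (1 - a)`, with `a = (1 + δ|s|²)⁻¹`, is the sum of `1 - a` from `a ∇s - ∇s` and
`2 δ |s|² a² = 2 a (1 - a) ≤ 2 (1 - a)` from the derivative of `a`. -/
theorem norm_covariantDerivative_softTruncation_sub_le (hD : D.IsMetricCompatible) {δ : ℝ}
    (hδ : 0 ≤ δ) {s : Π x : M, V x} {x : M}
    (hs : MDifferentiableAt I (I.prod 𝓘(ℝ, F)) (fun x => TotalSpace.mk' F x (s x)) x)
    (v : TangentSpace I x) :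
    ‖D (softTruncation δ s) x v - D s x v‖ ≤
      3 * (1 - (1 + δ * ‖s x‖ ^ 2)⁻¹) * ‖D s x v‖ := by
  have ht : 0 ≤ δ * ‖s x‖ ^ 2 := by positivity
  have hpos : 0 < 1 + δ * ‖s x‖ ^ 2 := by positivity
  set a := (1 + δ * ‖s x‖ ^ 2)⁻¹ with ha
  have ha0 : 0 ≤ a := inv_nonneg.mpr hpos.le
  have ha1 : a ≤ 1 := inv_le_one_of_one_le₀ (by linarith)
  have hta : δ * ‖s x‖ ^ 2 * a = 1 - a := by
    rw [ha]
    field_simp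
    ring
  have hrw : D (softTruncation δ s) x v - D s x v =
      -((1 - a) • D s x v + (2 * δ * a ^ 2 * inner ℝ (D s x v) (s x)) • s x) := by
    rw [covariantDerivative_softTruncation hD hδ hs, ← ha]
    module
  rw [hrw, norm_neg]
  calc ‖(1 - a) • D s x v + (2 * δ * a ^ 2 * inner ℝ (D s x v) (s x)) • s x‖
      ≤ (1 - a) * ‖D s x v‖ + 2 * δ * a ^ 2 * (‖D s x v‖ * ‖s x‖) * ‖s x‖ := by
        refine (norm_add_le _ _).trans ?_
        rw [norm_smul, norm_smul, Real.norm_of_nonneg (sub_nonneg.mpr ha1), norm_mul,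
          Real.norm_of_nonneg (by positivity : 0 ≤ 2 * δ * a ^ 2)]
        gcongr
        exact norm_inner_le_norm _ _
    _ = (1 - a) * ‖D s x v‖ + 2 * a * (δ * ‖s x‖ ^ 2 * a) * ‖D s x v‖ := by ring
    _ = (1 + 2 * a) * ((1 - a) * ‖D s x v‖) := by rw [hta]; ring
    _ ≤ 3 * ((1 - a) * ‖D s x v‖) := by
        have : 0 ≤ (1 - a) * ‖D s x v‖ := mul_nonneg (sub_nonneg.mpr ha1) (norm_nonneg _)
        gcongr
        linarith
    _ = 3 * (1 - a) * ‖D s x v‖ := by ring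

end

/-! ### Approximation of sections in `S₁` -/

section

variable {n : ℕ} {M : Type*} [TopologicalSpace M]
  [ChartedSpace (EuclideanSpace ℝ (Fin n)) M]
  {F : Type*} [NormedAddCommGroup F] [NormedSpace ℝ F]
  {V : M → Type*} [TopologicalSpace (TotalSpace F V)]
  [∀ x, NormedAddCommGroup (V x)] [∀ x, InnerProductSpace ℝ (V x)]
  [FiberBundle F V] [VectorBundle ℝ F V]
  {D : CovariantDerivative (𝓡 n) F V} {s : Π x : M, V x}

theorem normL2_sub_le_of_contMDiff [MeasurableSpace M] [BorelSpace M]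
    [RiemannianBundle (fun x : M => TangentSpace (𝓡 n) x)]
    [IsContMDiffRiemannianBundle (𝓡 n) ∞ F V] {r u : Π x : M, V x}
    (hr : ContMDiff (𝓡 n) ((𝓡 n).prod 𝓘(ℝ, F)) ∞ fun x => TotalSpace.mk' F x (r x))
    (hs : ContMDiff (𝓡 n) ((𝓡 n).prod 𝓘(ℝ, F)) ∞ fun x => TotalSpace.mk' F x (s x)) :
    normL2 n (r - u) ≤ normL2 n (r - s) + normL2 n (s - u) :=
  eLpNorm_two_le_add_of_le (fun _ => norm_nonneg _)
    (fun x => norm_sub_le_norm_sub_add_norm_sub (r x) (s x) (u x))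
    (hr.sub_section hs).continuous_norm_section.measurable.aemeasurable

variable [IsManifold (𝓡 n) ∞ M]

theorem contMDiff_covariantDerivative [CovariantDerivative.ContMDiffCovariantDerivative D ∞]
    (hs : ContMDiff (𝓡 n) ((𝓡 n).prod 𝓘(ℝ, F)) ∞ fun x => TotalSpace.mk' F x (s x)) :
    ContMDiff (𝓡 n) ((𝓡 n).prod 𝓘(ℝ, EuclideanSpace ℝ (Fin n) →L[ℝ] F)) ∞
      (fun x => TotalSpace.mk' (EuclideanSpace ℝ (Fin n) →L[ℝ] F)
        (E := fun x : M => TangentSpace (𝓡 n) x →L[ℝ] V x) x (D s x)) := by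
  rw [← contMDiffOn_univ]
  exact (CovariantDerivative.ContMDiffCovariantDerivative.contMDiff (cov := D)
    (k := ∞)).contMDiff (by simpa using hs.contMDiffOn)

variable [MeasurableSpace M] [RiemannianBundle (fun x : M => TangentSpace (𝓡 n) x)]

theorem MemS1.hasSobolevGradient (hs : MemS1 D s) : HasSobolevGradient D s (D s) := by
  refine ⟨hs.2.1, hs.2.2, fun _ => s, fun _ => hs, ?_, ?_⟩
  · simp [normL2]
  · simp [normL2Cotangent, cotangentTensorNorm]

variable [BorelSpace M] [IsContMDiffRiemannianBundle (𝓡 n) ∞ F V]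

theorem normL2Cotangent_sub_le_of_contMDiff
    [IsContMDiffRiemannianBundle (𝓡 n) ∞ (EuclideanSpace ℝ (Fin n))
      (fun x : M => TangentSpace (𝓡 n) x)]
    [CovariantDerivative.ContMDiffCovariantDerivative D ∞]
    {r : Π x : M, V x}
    {w : Π x : M, TangentSpace (𝓡 n) x →L[ℝ] V x}
    (hr : ContMDiff (𝓡 n) ((𝓡 n).prod 𝓘(ℝ, F)) ∞ fun x => TotalSpace.mk' F x (r x))
    (hs : ContMDiff (𝓡 n) ((𝓡 n).prod 𝓘(ℝ, F)) ∞ fun x => TotalSpace.mk' F x (s x)) :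
    normL2Cotangent (D r - w) ≤ normL2Cotangent (D r - D s) + normL2Cotangent (D s - w) := by
  have hsub := (contMDiff_covariantDerivative (D := D) hr).sub_section
    (contMDiff_covariantDerivative (D := D) hs)
  refine eLpNorm_two_le_add_of_le (fun _ => cotangentTensorNorm_nonneg _) (fun x => ?_)
    (continuous_cotangentTensorNorm (hsub.of_le (by simp))).measurable.aemeasurable
  have h : (D r - w) x = (D r - D s) x + (D s - w) x := by simp
  rw [h]
  exact cotangentTensorNorm_add_le _ _

variable [FiniteDimensional ℝ F] [ContMDiffVectorBundle ∞ F V (𝓡 n)]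
  [CovariantDerivative.ContMDiffCovariantDerivative D ∞]

/-- As `δ = 1 / (k + 1) → 0`, the soft truncations of `s ∈ S₁` converge to `s` in `W^{1,2}`. -/
theorem MemS1.tendsto_softTruncation
    [IsContMDiffRiemannianBundle (𝓡 n) ∞ (EuclideanSpace ℝ (Fin n))
      (fun x : M => TangentSpace (𝓡 n) x)]
    (hD : D.IsMetricCompatible) (hs : MemS1 D s) :
    Tendsto (fun k : ℕ => normL2 n (BundleSobolev.softTruncation (1 / ((k : ℝ) + 1)) s - s))
        atTop (𝓝 0) ∧
      Tendsto (fun k : ℕ =>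
        normL2Cotangent (D (BundleSobolev.softTruncation (1 / ((k : ℝ) + 1)) s) - D s))
        atTop (𝓝 0) := by
  let η : ℕ → M → ℝ := fun k x => 3 * (1 - (1 + 1 / ((k : ℝ) + 1) * ‖s x‖ ^ 2)⁻¹)
  have hδ : ∀ k : ℕ, 0 ≤ 1 / ((k : ℝ) + 1) := fun k => by positivity
  have hsn : Continuous fun x => ‖s x‖ := hs.1.continuous_norm_section
  have hη : ∀ k, AEMeasurable (η k) (riemannianVolume n M) := fun k => by
    have : Continuous (η k) := by
      refine continuous_const.mul (continuous_const.sub (Continuous.inv₀ (by fun_prop) fun x => ?_))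
      positivity
    exact this.measurable.aemeasurable
  have hη_nonneg : ∀ k x, 0 ≤ η k x := fun k x => by
    have h1 : 0 ≤ 1 / ((k : ℝ) + 1) * ‖s x‖ ^ 2 := by positivity
    have : (1 + 1 / ((k : ℝ) + 1) * ‖s x‖ ^ 2)⁻¹ ≤ 1 := inv_le_one_of_one_le₀ (by linarith)
    simp only [η]
    linarith
  have hηc : ∀ k x, |η k x| ≤ 3 := fun k x => by
    rw [abs_of_nonneg (hη_nonneg k x)]
    have : 0 ≤ (1 + 1 / ((k : ℝ) + 1) * ‖s x‖ ^ 2)⁻¹ := by positivity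
    simp only [η]
    linarith
  have hη0 : ∀ x, Tendsto (fun k => η k x) atTop (𝓝 0) := fun x => by
    have h1 : Tendsto (fun k : ℕ => 1 + 1 / ((k : ℝ) + 1) * ‖s x‖ ^ 2) atTop
        (𝓝 (1 + 0 * ‖s x‖ ^ 2)) :=
      (tendsto_one_div_add_atTop_nhds_zero_nat.mul_const _).const_add 1
    have h2 := ((h1.inv₀ (by simp)).const_sub 1).const_mul 3
    simpa [η] using h2
  refine ⟨tendsto_eLpNorm_two_zero_of_le_mul hsn.measurable.aemeasurable hs.2.1.2 hη hηc hη0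
    fun k x => ?_, tendsto_eLpNorm_two_zero_of_le_mul (continuous_cotangentTensorNorm
      ((contMDiff_covariantDerivative hs.1).of_le (by simp))).measurable.aemeasurable
      hs.2.2.2 hη hηc hη0 fun k x => ?_⟩
  · have h : (BundleSobolev.softTruncation (1 / ((k : ℝ) + 1)) s - s) x =
        -((1 - (1 + 1 / ((k : ℝ) + 1) * ‖s x‖ ^ 2)⁻¹) • s x) := by
      simp only [Pi.sub_apply, BundleSobolev.softTruncation, Pi.smul_apply']
      module
    have h0 : 0 ≤ 1 - (1 + 1 / ((k : ℝ) + 1) * ‖s x‖ ^ 2)⁻¹ := by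
      have := hη_nonneg k x
      simp only [η] at this
      linarith
    rw [h, norm_neg, norm_smul, Real.norm_of_nonneg h0, abs_of_nonneg (by positivity),
      abs_of_nonneg (mul_nonneg (hη_nonneg k x) (norm_nonneg _))]
    gcongr
    simp only [η]
    linarith
  · rw [abs_of_nonneg (cotangentTensorNorm_nonneg _),
      abs_of_nonneg (mul_nonneg (hη_nonneg k x) (cotangentTensorNorm_nonneg _))]
    exact cotangentTensorNorm_le_mul (hη_nonneg k x) fun v =>
      norm_covariantDerivative_softTruncation_sub_le hD (hδ k)
        (hs.1.mdifferentiableAt (by simp)) v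

variable [SecondCountableTopology M]

theorem MemS1.softTruncation (hD : D.IsMetricCompatible) (hs : MemS1 D s) {δ : ℝ} (hδ : 0 ≤ δ) :
    MemS1 D (softTruncation δ s) := by
  have hT := contMDiff_softTruncation hδ hs.1
  refine ⟨hT, ⟨measurableSection_of_continuous _ hT.continuous, ?_⟩,
    measurableSection_of_continuous _ (contMDiff_covariantDerivative hT).continuous, ?_⟩
  · refine (eLpNorm_mono fun x => ?_).trans_lt hs.2.1.2
    simpa using norm_softTruncation_le_norm hδ s x
  -- `4 = 3 + 1`: the distance of `∇s_δ` to `∇s`, and `∇s` itself.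
  · have h4 : ∀ x, cotangentTensorNorm (D (BundleSobolev.softTruncation δ s) x) ≤
        4 * cotangentTensorNorm (D s x) := fun x =>
      cotangentTensorNorm_le_mul (by norm_num) fun v => by
        have h := norm_covariantDerivative_softTruncation_sub_le hD hδ
          (hs.1.mdifferentiableAt (x := x) (by simp)) v
        have ha : 0 ≤ (1 + δ * ‖s x‖ ^ 2)⁻¹ := by positivity
        have h3 : 3 * (1 - (1 + δ * ‖s x‖ ^ 2)⁻¹) * ‖D s x v‖ ≤ 3 * ‖D s x v‖ := by
          gcongr
          linarith
        have := norm_le_norm_add_norm_sub' (D (BundleSobolev.softTruncation δ s) x v) (D s x v)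
        linarith
    have hle : normL2Cotangent (D (BundleSobolev.softTruncation δ s)) ≤
        ENNReal.ofReal 4 * normL2Cotangent (D s) :=
      eLpNorm_le_mul_eLpNorm_of_ae_le_mul (ae_of_all _ fun x => by
        rw [Real.norm_of_nonneg (cotangentTensorNorm_nonneg _),
          Real.norm_of_nonneg (cotangentTensorNorm_nonneg _)]
        exact h4 x) 2
    exact hle.trans_lt (ENNReal.mul_lt_top ENNReal.ofReal_lt_top hs.2.2.2)

theorem MemS1.memLinfty_softTruncation (hD : D.IsMetricCompatible) (hs : MemS1 D s) {δ : ℝ}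
    (hδ : 0 < δ) : MemLinfty n F (BundleSobolev.softTruncation δ s) :=
  ⟨(hs.softTruncation hD hδ.le).2.1.1, 1 + δ⁻¹, by positivity,
    ae_of_all _ (norm_softTruncation_le hδ s)⟩

end

end BundleSobolev

theorem lemma4p1 {n : ℕ} {M : Type*} [TopologicalSpace M] [T2Space M]
    [SecondCountableTopology M] [ChartedSpace (EuclideanSpace ℝ (Fin n)) M]
    [IsManifold (𝓡 n) ∞ M] [MeasurableSpace M] [BorelSpace M]
    [RiemannianBundle (fun x : M => TangentSpace (𝓡 n) x)]
    [IsContMDiffRiemannianBundle (𝓡 n) ∞ (EuclideanSpace ℝ (Fin n))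
      (fun x : M => TangentSpace (𝓡 n) x)]
    {F : Type*} [NormedAddCommGroup F] [NormedSpace ℝ F] [FiniteDimensional ℝ F]
    {V : M → Type*} [TopologicalSpace (TotalSpace F V)]
    [∀ x, NormedAddCommGroup (V x)] [∀ x, InnerProductSpace ℝ (V x)]
    [FiberBundle F V] [VectorBundle ℝ F V] [ContMDiffVectorBundle ∞ F V (𝓡 n)]
    [IsContMDiffRiemannianBundle (𝓡 n) ∞ F V]
    (D : CovariantDerivative (𝓡 n) F V) [CovariantDerivative.ContMDiffCovariantDerivative D ∞]
    (hD : D.IsMetricCompatible)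
    (u : Π x : M, V x) (w : Π x : M, TangentSpace (𝓡 n) x →L[ℝ] V x)
    (hu : BundleSobolev.HasSobolevGradient D u w) (ε : ℝ≥0∞) (hε : 0 < ε) :
    ∃ (u' : Π x : M, V x) (w' : Π x : M, TangentSpace (𝓡 n) x →L[ℝ] V x),
      BundleSobolev.HasSobolevGradient D u' w' ∧
      BundleSobolev.MemLinfty n F u' ∧
      BundleSobolev.normL2 n (u' - u) + BundleSobolev.normL2Cotangent (w' - w) < ε := by
  obtain ⟨-, -, σ, hσ, hσu, hσw⟩ := hu
  -- A member `σ k` of `S₁` within `ε / 2` of `u`, and then a soft truncation of it within `ε / 2`.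
  have hsum := hσu.add hσw
  rw [add_zero] at hsum
  obtain ⟨k, hk⟩ := (hsum.eventually_lt_const (ENNReal.half_pos hε.ne')).exists
  have hs : BundleSobolev.MemS1 D (σ k) := hσ k
  obtain ⟨ht, htD⟩ := hs.tendsto_softTruncation hD
  have htsum := ht.add htD
  rw [add_zero] at htsum
  obtain ⟨m, hm⟩ := (htsum.eventually_lt_const (ENNReal.half_pos hε.ne')).exists
  have hδ : (0 : ℝ) < 1 / ((m : ℝ) + 1) := by positivity
  have hr := hs.softTruncation hD hδ.le
  refine ⟨_, _, hr.hasSobolevGradient, hs.memLinfty_softTruncation hD hδ, ?_⟩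
  calc _ ≤ _ := add_le_add (BundleSobolev.normL2_sub_le_of_contMDiff hr.1 hs.1)
        (BundleSobolev.normL2Cotangent_sub_le_of_contMDiff hr.1 hs.1)
    _ = _ := add_add_add_comm _ _ _ _
    _ < ε / 2 + ε / 2 := ENNReal.add_lt_add hm hk
    _ = ε := ENNReal.add_halves ε
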